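/- Conventions. A *Hermitian symmetric space* is a connected Hausdorff finite-dimensional complex manifold with a smooth Riemannian metric for which the complex structure $J$ is orthogonal, such that every point is an isolated fixed point of some holomorphic involutive isometry. A *real form* of a Hermitian symmetric space $X$ with involutive isometry $\sigma$ is the fixed-point set, assumed nonempty, of an antiholomorphic involutive isometry $\sigma : X \to X$. A complex submanifold of $X$ is the image of an injective holomorphic immersion, and it carries the restricted metric. Let $M$ be a Hermitian symmetric space of complex dimension $n$. A real form $B$ of $M$ is called *recursive* if there are Hermitian symmetric spaces $$M_1\subset M_2\subset\cdots\subset M_{n-1}\subset M$$ such that 1. $\dim_{\mathbf C} M_k=k$, and each $M_k$ is a complex submanifold of $M$ with complex structure and metric restricted from $M$; 2. $M_{n-1}$ is totally geodesic in $M$, and each $M_k$ with $k\le n-2$ is a totally geodesic complex submanifold of $M_{k+1}$; 3. $B\cap M_k$ is a real form of $M_k$ for $1\le k\le n-1$; 4. for $2\le l\le n-1$, the set $(B\cap M_l)\cup M_{l-1}$ is contained in the closure, in $M_l$, of a smooth real hypersurface of $M_l$. **Theorem.** Let $M$ and $N$ be Hermitian symmetric spaces, let $B_1$ be a recursive real form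 of $M$ with involutive isometry $\sigma_1$, let $B_2$ be a real form of $N$ with involutive isometry $\sigma_2$, and let $f:M\to N$ be a holomorphic map with $f(B_1)\subset B_2$. Then $$f(\sigma_1(p))=\sigma_2(f(p))\qquad\text{for all }p\in M .$$ -/

import Mathlib

open scoped Manifold ContDiff Topology
open Set

universe u v

/-- A complex (analytic) manifold is, with the same charts, a real analytic manifold. -/
instance isManifold_real_of_complex {E : Type*} [NormedAddCommGroup E] [NormedSpace ℂ E]
    {X : Type*} [TopologicalSpace X] [ChartedSpace E X] [IsManifold 𝓘(ℂ, E) ω X] :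
    IsManifold 𝓘(ℝ, E) ω X := by
  apply isManifold_of_contDiffOn
  intro e e' he he'
  have h := (contDiffGroupoid ω 𝓘(ℂ, E)).compatible he he'
  rw [contDiffGroupoid, mem_groupoid_of_pregroupoid] at h
  have h1 : ContDiffOn ℂ ω (𝓘(ℂ, E) ∘ (e.symm ≫ₕ e') ∘ 𝓘(ℂ, E).symm)
      (𝓘(ℂ, E).symm ⁻¹' (e.symm ≫ₕ e').source ∩ range 𝓘(ℂ, E)) := h.1
  exact h1.restrict_scalars ℝ

/-- The complex structure of a complex manifold: multiplication by `i` on the real tangent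
space at `x`. -/
def tangentJ {E : Type*} [NormedAddCommGroup E] [NormedSpace ℂ E]
    {X : Type*} [TopologicalSpace X] [ChartedSpace E X] {x : X}
    (w : TangentSpace 𝓘(ℝ, E) x) : TangentSpace 𝓘(ℝ, E) x :=
  let w₀ : E := w
  Complex.I • w₀

/-- A connected Hermitian manifold modelled on the complex vector space `E`: a connected Hausdorff
complex manifold with a smooth Riemannian metric for which the complex structure is orthogonal. -/
structure HermitianManifold (E : Type*) [NormedAddCommGroup E] [NormedSpace ℂ E] where
  carrier : Type u
  [topologicalSpace : TopologicalSpace carrier]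
  [t2Space : T2Space carrier]
  [connectedSpace : ConnectedSpace carrier]
  [chartedSpace : ChartedSpace E carrier]
  [isManifold : IsManifold 𝓘(ℂ, E) ω carrier]
  metric : Bundle.ContMDiffRiemannianMetric 𝓘(ℝ, E) ∞ E
    (fun x : carrier => TangentSpace 𝓘(ℝ, E) x)
  metric_J : ∀ (x : carrier) (w w' : TangentSpace 𝓘(ℝ, E) x),
    metric.inner x (tangentJ w) (tangentJ w') = metric.inner x w w'

instance {E : Type*} [NormedAddCommGroup E] [NormedSpace ℂ E] :
    CoeSort (HermitianManifold.{u} E) (Type u) := ⟨HermitianManifold.carrier⟩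

attribute [instance] HermitianManifold.topologicalSpace HermitianManifold.t2Space
  HermitianManifold.connectedSpace HermitianManifold.chartedSpace HermitianManifold.isManifold

section maps

variable {E F : Type*} [NormedAddCommGroup E] [NormedSpace ℂ E]
  [NormedAddCommGroup F] [NormedSpace ℂ F]

/-- The map `f` pulls back the metric of `Y` to the metric of `X`. -/
def PreservesMetric (X : HermitianManifold.{u} E) (Y : HermitianManifold.{v} F) (f : X → Y) :
    Prop :=
  ∀ (x : X) (w w' : TangentSpace 𝓘(ℝ, E) x),
    Y.metric.inner (f x) (mfderiv 𝓘(ℝ, E) 𝓘(ℝ, F) f x w) (mfderiv 𝓘(ℝ, E) 𝓘(ℝ, F) f x w') =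
      X.metric.inner x w w'

/-- An involutive isometry (a smooth involution preserving the metric). -/
structure IsInvolutiveIsometry (X : HermitianManifold.{u} E) (s : X → X) : Prop where
  contMDiff : ContMDiff 𝓘(ℝ, E) 𝓘(ℝ, E) ∞ s
  preservesMetric : PreservesMetric X X s
  involutive : Function.Involutive s

/-- A smooth map is antiholomorphic if its differential anticommutes with the complex structure. -/
def IsAntiholomorphic (X : HermitianManifold.{u} E) (s : X → X) : Prop :=
  ContMDiff 𝓘(ℝ, E) 𝓘(ℝ, E) ∞ s ∧
    ∀ (x : X) (w : TangentSpace 𝓘(ℝ, E) x),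
      mfderiv 𝓘(ℝ, E) 𝓘(ℝ, E) s x (tangentJ w) = -tangentJ (mfderiv 𝓘(ℝ, E) 𝓘(ℝ, E) s x w)

/-- `B` is the real form of `X` with involutive isometry `s`: the (nonempty) fixed-point set of the
antiholomorphic involutive isometry `s`. -/
structure IsRealForm (X : HermitianManifold.{u} E) (s : X → X) (B : Set X) : Prop where
  isometry : IsInvolutiveIsometry X s
  antiholomorphic : IsAntiholomorphic X s
  eq_fixedPoints : B = Function.fixedPoints s
  nonempty : B.Nonempty

/-- The coefficients of the metric, read in the chart around `x₀`, at the point `y` of the model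
space. -/
noncomputable def metricInChart (X : HermitianManifold.{u} E) (x₀ : X) (y a b : E) : ℝ :=
  let φ := extChartAt 𝓘(ℝ, E) x₀
  X.metric.inner (φ.symm y) (mfderiv 𝓘(ℝ, E) 𝓘(ℝ, E) φ.symm y a)
    (mfderiv 𝓘(ℝ, E) 𝓘(ℝ, E) φ.symm y b)

/-- `γ` is a geodesic on the open set `T` of parameters. At each time the geodesic equation is
written in the chart `x` around the current point, with both sides paired with a vector `e`:
`g(x'', e) + (∂_{x'} g)(x', e) = ½ (∂_e g)(x', x')`, that is,
`g_{kl} (x''^l + Γ^l_{ij} x'^i x'^j) = 0`. -/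
def IsGeodesicOn (X : HermitianManifold.{u} E) (γ : ℝ → X) (T : Set ℝ) : Prop :=
  ContMDiffOn 𝓘(ℝ, ℝ) 𝓘(ℝ, E) ∞ γ T ∧
    ∀ t ∈ T, ∀ e : E,
      let c : ℝ → E := fun r => extChartAt 𝓘(ℝ, E) (γ t) (γ r)
      let g : E → E → E → ℝ := metricInChart X (γ t)
      g (c t) (deriv (deriv c) t) e + fderiv ℝ (fun y => g y (deriv c t) e) (c t) (deriv c t) =
        (1 / 2) * fderiv ℝ (fun y => g y (deriv c t) (deriv c t)) (c t) e

/-- `f` exhibits `X` as a complex submanifold of `Y` with the induced metric: an injective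
holomorphic map pulling back the metric of `Y` to that of `X` (hence an immersion). -/
structure IsHermitianSubmanifold (X : HermitianManifold.{u} E) (Y : HermitianManifold.{v} F)
    (f : X → Y) : Prop where
  injective : Function.Injective f
  holomorphic : MDifferentiable 𝓘(ℂ, E) 𝓘(ℂ, F) f
  preservesMetric : PreservesMetric X Y f

/-- The submanifold `f : X → Y` is totally geodesic: geodesics of `X` are geodesics of `Y`. -/
def IsTotallyGeodesic (X : HermitianManifold.{u} E) (Y : HermitianManifold.{v} F) (f : X → Y) :
    Prop :=
  ∀ (γ : ℝ → X) (T : Set ℝ), IsOpen T → IsGeodesicOn X γ T → IsGeodesicOn Y (f ∘ γ) T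

/-- `H` is an (embedded) smooth real hypersurface: locally a regular level set. -/
def IsSmoothRealHypersurface (X : HermitianManifold.{u} E) (H : Set X) : Prop :=
  ∀ p ∈ H, ∃ (U : Set X) (ρ : X → ℝ), IsOpen U ∧ p ∈ U ∧
    ContMDiffOn 𝓘(ℝ, E) 𝓘(ℝ, ℝ) ∞ ρ U ∧
    (∀ q ∈ U, mfderiv 𝓘(ℝ, E) 𝓘(ℝ, ℝ) ρ q ≠ 0) ∧
    H ∩ U = {q ∈ U | ρ q = 0}

end maps

/-- A Hermitian symmetric space: a connected Hermitian manifold each point of which is an isolated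
fixed point of a holomorphic involutive isometry. -/
structure HermitianSymmetricSpace (E : Type*) [NormedAddCommGroup E] [NormedSpace ℂ E]
    extends HermitianManifold.{u} E where
  exists_symmetry : ∀ p : carrier, ∃ s : carrier → carrier,
    IsInvolutiveIsometry toHermitianManifold s ∧ MDifferentiable 𝓘(ℂ, E) 𝓘(ℂ, E) s ∧
      s p = p ∧ ∀ᶠ q in 𝓝[≠] p, s q ≠ q

instance {E : Type*} [NormedAddCommGroup E] [NormedSpace ℂ E] :
    CoeSort (HermitianSymmetricSpace.{u} E) (Type u) := ⟨fun X => X.toHermitianManifold.carrier⟩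

/-- `B` is a recursive real form of `M`, of complex dimension `n`, with involutive isometry `σ`.
The members `M_1 ⊂ ⋯ ⊂ M_{n-1} ⊂ M` of the chain are given as Hermitian symmetric spaces
`X k` modelled on `ℂ^k` with inclusion maps `ι k : X k → M`; only the indices `1 ≤ k < n` matter. -/
structure IsRecursiveRealForm {E : Type*} [NormedAddCommGroup E] [NormedSpace ℂ E]
    (M : HermitianSymmetricSpace.{u} E) (σ : M → M) (B : Set M) : Prop where
  isRealForm : IsRealForm M.toHermitianManifold σ B
  exists_chain : ∃ (X : ∀ k : ℕ, HermitianSymmetricSpace.{u} (EuclideanSpace ℂ (Fin k)))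
    (ι : ∀ k : ℕ, X k → M),
    -- complex submanifolds of `M` with the restricted metric
    (∀ k, 1 ≤ k → k < Module.finrank ℂ E →
      IsHermitianSubmanifold (X k).toHermitianManifold M.toHermitianManifold (ι k)) ∧
    -- the largest one is totally geodesic in `M`
    (∀ k, 1 ≤ k → k + 1 = Module.finrank ℂ E →
      IsTotallyGeodesic (X k).toHermitianManifold M.toHermitianManifold (ι k)) ∧
    -- each one is a totally geodesic submanifold of the next
    (∀ k, 1 ≤ k → k + 1 < Module.finrank ℂ E → ∃ j : X k → X (k + 1), ι (k + 1) ∘ j = ι k ∧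
      IsHermitianSubmanifold (X k).toHermitianManifold (X (k + 1)).toHermitianManifold j ∧
      IsTotallyGeodesic (X k).toHermitianManifold (X (k + 1)).toHermitianManifold j) ∧
    -- each `B ∩ M_k` is a real form of `M_k`
    (∀ k, 1 ≤ k → k < Module.finrank ℂ E →
      ∃ τ : X k → X k, IsRealForm (X k).toHermitianManifold τ (ι k ⁻¹' B)) ∧
    -- `(B ∩ M_l) ∪ M_{l-1}` lies in the closure of a smooth real hypersurface of `M_l`
    (∀ l, 2 ≤ l → l < Module.finrank ℂ E → ∃ H : Set (X l),
      IsSmoothRealHypersurface (X l).toHermitianManifold H ∧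
      ι l ⁻¹' (B ∪ range (ι (l - 1))) ⊆ closure H)

/-! Put `g = σ₂ ∘ f ∘ σ₁`. Conjugating by two antiholomorphic maps keeps `g` holomorphic, and `f =
g` on `B₁`, because `σ₁` fixes `B₁` pointwise and `σ₂` fixes `f(B₁) ⊂ B₂`. The fixed set of an
antiholomorphic involution is totally real of maximal dimension, so a holomorphic germ at a fixed
point that vanishes on it vanishes identically (`eventually_eq_zero_of_eq_zero_on_fixed`). Hence `f
= g` near a point of `B₁`, and everywhere on the connected `M` by the identity theorem
(`MDifferentiable.eq_of_eventually_eq`). The germ statement is reduced to an antilinear involution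
by a holomorphic change of coordinates that linearises the involution. In the linear case each
vector is `v + i w` with `v`, `w` fixed, and one complex variable suffices. -/

/-! ### Holomorphic germs and antiholomorphic involutions on a vector space. -/

section linear

variable {E F : Type*} [NormedAddCommGroup E] [NormedSpace ℂ E]
  [NormedAddCommGroup F] [NormedSpace ℂ F]

/-- A holomorphic germ vanishing on the fixed space of an antilinear involution vanishes. -/
theorem eventually_eq_zero_of_eq_zero_on_fixed_linear [CompleteSpace F] (A : E →L[ℝ] E)
    (hA : ∀ w, A (Complex.I • w) = -(Complex.I • A w)) (hAA : ∀ w, A (A w) = w) {H : E → F}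
    (hH : ∀ᶠ z in 𝓝 0, DifferentiableAt ℂ H z) (h0 : ∀ᶠ v in 𝓝 0, A v = v → H v = 0) :
    ∀ᶠ z in 𝓝 0, H z = 0 := by
  obtain ⟨r, hr, hball⟩ := Metric.eventually_nhds_iff_ball.1 (hH.and h0)
  -- Real and imaginary parts with respect to `A`: both `v z` and `w z` are fixed by `A`, and `z = v
  -- z + i w z`.
  let v : E → E := fun z => (1 / 2 : ℝ) • (z + A z)
  let w : E → E := fun z => (1 / 2 : ℝ) • (-(Complex.I • (z - A z)))
  have hvA : ∀ z, A (v z) = v z := fun z => by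
    simp only [v, map_smul, map_add, hAA, add_comm]
  have hwA : ∀ z, A (w z) = w z := fun z => by
    simp only [w, map_smul, map_neg, hA, map_sub, hAA, neg_neg]
    rw [← smul_neg, neg_sub]
  have hvw : ∀ z, v z + Complex.I • w z = z := fun z => by
    simp only [v, w]
    rw [smul_comm Complex.I (1 / 2 : ℝ), smul_neg, smul_smul, Complex.I_mul_I, ← smul_add]
    rw [neg_one_smul, neg_neg, add_add_sub_cancel, ← two_smul ℝ z, smul_smul]
    norm_num
  -- The factor 2 keeps `v z + ζ w z` in the ball for all `|ζ| < 2`, a disc containing both 0 and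
  -- `I`.
  have hsmall : ∀ᶠ z in 𝓝 (0 : E), ‖v z‖ + 2 * ‖w z‖ < r := by
    have hc : Continuous fun z => ‖v z‖ + 2 * ‖w z‖ := by fun_prop
    apply hc.continuousAt.eventually_lt continuousAt_const
    simpa [v, w] using hr
  filter_upwards [hsmall] with z hz
  have hmem : ∀ ζ : ℂ, ‖ζ‖ < 2 → v z + ζ • w z ∈ Metric.ball (0 : E) r := fun ζ hζ => by
    rw [mem_ball_zero_iff]
    calc ‖v z + ζ • w z‖ ≤ ‖v z‖ + ‖ζ‖ * ‖w z‖ := by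
          simpa [norm_smul] using norm_add_le (v z) (ζ • w z)
      _ ≤ ‖v z‖ + 2 * ‖w z‖ := by gcongr
      _ < r := hz
  have hdiff : DifferentiableOn ℂ (fun ζ : ℂ => H (v z + ζ • w z)) (Metric.ball 0 2) := by
    intro ζ hζ
    have h1 := (hball _ (hmem ζ (mem_ball_zero_iff.1 hζ))).1
    have h2 : DifferentiableAt ℂ (fun ζ : ℂ => v z + ζ • w z) ζ := by fun_prop
    exact (DifferentiableAt.comp ζ h1 h2).differentiableWithinAt
  have hreal : ∀ t : ℝ, |t| < 2 → H (v z + (t : ℂ) • w z) = 0 := fun t ht => by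
    refine (hball _ (hmem t (by simpa using ht))).2 ?_
    rw [Complex.coe_smul, map_add, hvA, map_smul A t, hwA]
  -- For real `ζ` the point is fixed by `A`, so the one-variable function has zeros accumulating at
  -- 0. It therefore vanishes on the disc, and `ζ = I` gives `H z = 0`.
  have hfreq : ∃ᶠ ζ : ℂ in 𝓝[≠] 0, H (v z + ζ • w z) = 0 := by
    have ht : Filter.Tendsto (fun t : ℝ => (t : ℂ)) (𝓝[≠] 0) (𝓝[≠] 0) := by
      refine tendsto_nhdsWithin_iff.2 ⟨?_, ?_⟩
      · exact (Complex.continuous_ofReal.tendsto' 0 0 (by simp)).mono_left nhdsWithin_le_nhds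
      · filter_upwards [self_mem_nhdsWithin] with t ht
        simpa using ht
    refine ht.frequently (Filter.Eventually.frequently ?_)
    have : ∀ᶠ t : ℝ in 𝓝 0, |t| < 2 :=
      continuous_abs.continuousAt.eventually_lt continuousAt_const (by simp)
    exact (this.filter_mono nhdsWithin_le_nhds).mono fun t ht => hreal t ht
  have key := (hdiff.analyticOnNhd Metric.isOpen_ball).eqOn_zero_of_preconnected_of_frequently_eq_zero
    (convex_ball _ _).isPreconnected (Metric.mem_ball_self two_pos) hfreq
  have := key (show Complex.I ∈ Metric.ball (0 : ℂ) 2 by simp)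
  simpa [hvw] using this

/-- A real linear derivative commuting with `i` is a complex derivative. -/
theorem HasFDerivAt.complex_of_map_I_smul {f : E → F} {L : E →L[ℝ] F} {x : E}
    (h : HasFDerivAt f L x) (hL : ∀ w, L (Complex.I • w) = Complex.I • L w) :
    ∃ L' : E →L[ℂ] F, L'.restrictScalars ℝ = L ∧ HasFDerivAt f L' x := by
  have hsmul : ∀ (c : ℂ) (w : E), L (c • w) = c • L w := fun c w => by
    rw [← Complex.re_add_im c, add_smul, add_smul, map_add, mul_smul, mul_smul, Complex.coe_smul,
      Complex.coe_smul, Complex.coe_smul, Complex.coe_smul, map_smul, map_smul, hL]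
  let L' : E →L[ℂ] F :=
    { toFun := L, map_add' := L.map_add, map_smul' := hsmul, cont := L.cont }
  have h1 : L'.restrictScalars ℝ = L := by ext; rfl
  exact ⟨L', h1, hasFDerivAt_of_restrictScalars ℝ h h1⟩

/-- A map of class `C^1` whose derivative is invertible at `y₀` and complex linear near `y₀` has
a holomorphic local inverse. -/
theorem exists_holomorphic_local_inverse [FiniteDimensional ℂ E] {ψ : E → E} {y₀ : E}
    (hψ : ContDiffAt ℝ 1 ψ y₀) (hinv : fderiv ℝ ψ y₀ ∈
      range (ContinuousLinearEquiv.toContinuousLinearMap : (E ≃L[ℝ] E) → E →L[ℝ] E))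
    (hI : ∀ᶠ y in 𝓝 y₀, ∀ w, fderiv ℝ ψ y (Complex.I • w) = Complex.I • fderiv ℝ ψ y w) :
    ∃ Ψ : OpenPartialHomeomorph E E, y₀ ∈ Ψ.source ∧ (∀ y, Ψ y = ψ y) ∧
      ∀ᶠ z in 𝓝 (ψ y₀), DifferentiableAt ℂ Ψ.symm z := by
  have : CompleteSpace E := FiniteDimensional.complete ℂ E
  obtain ⟨e, he⟩ := hinv
  have hs : HasStrictFDerivAt ψ (e : E →L[ℝ] E) y₀ := by
    rw [he]; exact hψ.hasStrictFDerivAt one_ne_zero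
  let Ψ := hs.toOpenPartialHomeomorph ψ
  have hsrc : y₀ ∈ Ψ.source := hs.mem_toOpenPartialHomeomorph_source
  have hcoe : ∀ y, Ψ y = ψ y := fun y => rfl
  refine ⟨Ψ, hsrc, hcoe, ?_⟩
  have hcont : ContinuousAt (fderiv ℝ ψ) y₀ :=
    (hψ.fderiv_right (m := 0) (by norm_num)).continuousAt
  have hrange : ∀ᶠ y in 𝓝 y₀, fderiv ℝ ψ y ∈
      range (ContinuousLinearEquiv.toContinuousLinearMap : (E ≃L[ℝ] E) → E →L[ℝ] E) := by
    apply hcont.eventually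
    rw [← he]
    -- Invertible operators form an open set, so the derivative stays invertible near `y₀`.
    exact e.nhds
  have hd : ∀ᶠ y in 𝓝 y₀, DifferentiableAt ℝ ψ y :=
    (hψ.eventually (by simp)).mono fun y hy => hy.differentiableAt one_ne_zero
  have hsymm : Filter.Tendsto Ψ.symm (𝓝 (ψ y₀)) (𝓝 y₀) := by
    have := Ψ.tendsto_symm hsrc
    rwa [hcoe] at this
  filter_upwards [hsymm.eventually (hrange.and (hd.and hI)),
    Ψ.open_target.mem_nhds (Ψ.map_source hsrc)] with z ⟨⟨e', he'⟩, hdz, hIz⟩ hz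
  obtain ⟨L, hL, hLd⟩ := hdz.hasFDerivAt.complex_of_map_I_smul hIz
  have hLe : ∀ w, L w = e' w := fun w => by
    have := congrArg (fun T : E →L[ℝ] E => T w) (hL.trans he'.symm)
    exact this
  have hbij : Function.Bijective L := by
    have : (L : E → E) = e' := funext hLe
    rw [this]; exact e'.bijective
  let c : E ≃L[ℂ] E := ContinuousLinearEquiv.ofBijective L
    (LinearMap.ker_eq_bot.2 hbij.1) (LinearMap.range_eq_top.2 hbij.2)
  have hc : (c : E →L[ℂ] E) = L := by ext w; rfl
  exact (Ψ.hasFDerivAt_symm (f' := c) hz (by rw [hc]; exact hLd)).differentiableAt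

/-- A holomorphic germ vanishing on the fixed-point set of an antiholomorphic involution
vanishes. -/
theorem eventually_eq_zero_of_eq_zero_on_fixed [FiniteDimensional ℂ E] [CompleteSpace F]
    {s : E → E} {y₀ : E} {h : E → F} (hs : ContDiffAt ℝ 1 s y₀) (hs₀ : s y₀ = y₀)
    (hanti : ∀ᶠ y in 𝓝 y₀, ∀ w, fderiv ℝ s y (Complex.I • w) = -(Complex.I • fderiv ℝ s y w))
    (hinv : ∀ᶠ y in 𝓝 y₀, s (s y) = y) (hh : ∀ᶠ y in 𝓝 y₀, DifferentiableAt ℂ h y)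
    (hfix : ∀ᶠ y in 𝓝 y₀, s y = y → h y = 0) : ∀ᶠ y in 𝓝 y₀, h y = 0 := by
  let A : E →L[ℝ] E := fderiv ℝ s y₀
  have hA : ∀ w, A (Complex.I • w) = -(Complex.I • A w) := hanti.self_of_nhds
  have hsd : HasFDerivAt s A y₀ := (hs.differentiableAt one_ne_zero).hasFDerivAt
  have hAA : ∀ w, A (A w) = w := by
    have h1 : HasFDerivAt (s ∘ s) (A.comp A) y₀ := by
      refine HasFDerivAt.comp y₀ ?_ hsd
      rwa [hs₀]
    have h2 : HasFDerivAt (s ∘ s) (ContinuousLinearMap.id ℝ E) y₀ :=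
      (hasFDerivAt_id y₀).congr_of_eventuallyEq hinv
    intro w
    exact congrArg (fun T : E →L[ℝ] E => T w) (h1.unique h2)
  -- Averaging over the group generated by `s`, up to a factor 2: since `s² = 1` and `A² = 1`, `ψ ∘
  -- s = A ∘ ψ` near `y₀`. The derivative of `ψ` is complex linear near `y₀`, as `A` and the
  -- derivative of `s` are both antilinear.
  let ψ : E → E := fun y => (y - y₀) + A (s y - y₀)
  have hψ₀ : ψ y₀ = 0 := by simp [ψ, hs₀]
  have hψd : ∀ y, DifferentiableAt ℝ s y →
      fderiv ℝ ψ y = ContinuousLinearMap.id ℝ E + A.comp (fderiv ℝ s y) := fun y hy =>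
    (((hasFDerivAt_id y).sub_const y₀).add
      (A.hasFDerivAt.comp y (hy.hasFDerivAt.sub_const y₀))).fderiv
  have hψ : ContDiffAt ℝ 1 ψ y₀ :=
    (contDiffAt_id.sub contDiffAt_const).add
      (A.contDiff.contDiffAt.comp y₀ (hs.sub contDiffAt_const))
  have hd : ∀ᶠ y in 𝓝 y₀, DifferentiableAt ℝ s y :=
    (hs.eventually (by simp)).mono fun y hy => hy.differentiableAt one_ne_zero
  have hψI : ∀ᶠ y in 𝓝 y₀, ∀ w, fderiv ℝ ψ y (Complex.I • w) = Complex.I • fderiv ℝ ψ y w := by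
    filter_upwards [hd, hanti] with y hy hay w
    simp [hψd y hy, hay, hA]
  have hrange : fderiv ℝ ψ y₀ ∈
      range (ContinuousLinearEquiv.toContinuousLinearMap : (E ≃L[ℝ] E) → E →L[ℝ] E) := by
    -- At `y₀` the derivative is `1 + A² = 2`.
    refine ⟨ContinuousLinearEquiv.smulLeft (Units.mk0 (2 : ℝ) two_ne_zero), ?_⟩
    rw [hψd y₀ hsd.differentiableAt]
    ext w
    have : fderiv ℝ s y₀ = A := rfl
    simp [this, hAA, two_smul, Units.smul_def]
  obtain ⟨Ψ, hsrc, hcoe, hsymm⟩ := exists_holomorphic_local_inverse hψ hrange hψI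
  rw [hψ₀] at hsymm
  have htend : Filter.Tendsto Ψ.symm (𝓝 0) (𝓝 y₀) := by
    have := Ψ.tendsto_symm hsrc
    rwa [hcoe, hψ₀] at this
  have h0t : (0 : E) ∈ Ψ.target := by
    rw [← hψ₀, ← hcoe]; exact Ψ.map_source hsrc
  have hstend : Filter.Tendsto s (𝓝 y₀) (𝓝 y₀) := by
    have := hs.continuousAt.tendsto
    rwa [hs₀] at this
  have hHd : ∀ᶠ z in 𝓝 (0 : E), DifferentiableAt ℂ (h ∘ Ψ.symm) z := by
    filter_upwards [hsymm, htend.eventually hh] with z h1 h2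
    exact h2.comp z h1
  have hHfix : ∀ᶠ v in 𝓝 (0 : E), A v = v → (h ∘ Ψ.symm) v = 0 := by
    filter_upwards [htend.eventually hfix, htend.eventually hinv, Ψ.open_target.mem_nhds h0t,
      (hstend.comp htend).eventually (Ψ.open_source.mem_nhds hsrc)] with v h1 h2 h3 h4 hv
    -- If `A v = v`, then `y = Ψ.symm v` and `s y` have the same image under `ψ`, so injectivity
    -- gives `s y = y`.
    refine h1 (Ψ.injOn h4 (Ψ.map_target h3) ?_)
    have h5 : ψ (Ψ.symm v) = v := by rw [← hcoe]; exact Ψ.right_inv h3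
    rw [Ψ.right_inv h3, Function.comp_apply, hcoe]
    calc ψ (s (Ψ.symm v)) = A (ψ (Ψ.symm v)) := by
          simp only [ψ, h2, map_add, hAA, add_comm]
      _ = v := by rw [h5, hv]
  have hH := eventually_eq_zero_of_eq_zero_on_fixed_linear A hA hAA hHd hHfix
  have hΨt : Filter.Tendsto Ψ (𝓝 y₀) (𝓝 0) := by
    have := (Ψ.continuousAt hsrc).tendsto
    rwa [hcoe, hψ₀] at this
  filter_upwards [hΨt.eventually hH, Ψ.open_source.mem_nhds hsrc] with y hy hys
  rwa [Function.comp_apply, Ψ.left_inv hys] at hy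

/-- The identity theorem on a ball. -/
theorem eqOn_zero_ball_of_eventually [CompleteSpace F] {h : E → F} {x a : E} {r : ℝ}
    (hh : DifferentiableOn ℂ h (Metric.ball x r)) (ha : a ∈ Metric.ball x r)
    (h0 : ∀ᶠ y in 𝓝 a, h y = 0) : EqOn h 0 (Metric.ball x r) := by
  intro b hb
  -- Restricting to the complex line through `a` and `b` reduces to one variable; the slice of the
  -- ball is convex, hence connected.
  let ℓ : ℂ → E := fun ζ => a + ζ • (b - a)
  have hℓ : Differentiable ℂ ℓ := by fun_prop
  have hconv : Convex ℝ (ℓ ⁻¹' Metric.ball x r) := by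
    intro ζ hζ η hη s t hs ht hst
    have : ℓ (s • ζ + t • η) = s • ℓ ζ + t • ℓ η := by
      simp only [ℓ, smul_add, add_smul, smul_assoc]
      have : a = s • a + t • a := by rw [← add_smul, hst, one_smul]
      nth_rewrite 1 [this]
      abel
    rw [mem_preimage, this]
    exact convex_ball x r hζ hη hs ht hst
  have hd : DifferentiableOn ℂ (h ∘ ℓ) (ℓ ⁻¹' Metric.ball x r) :=
    hh.comp hℓ.differentiableOn (mapsTo_preimage _ _)
  have hev : h ∘ ℓ =ᶠ[𝓝 0] 0 := by
    have : Filter.Tendsto ℓ (𝓝 0) (𝓝 a) := hℓ.continuous.tendsto' 0 a (by simp [ℓ])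
    exact this.eventually h0
  have han := hd.analyticOnNhd (Metric.isOpen_ball.preimage hℓ.continuous)
  have := han.eqOn_zero_of_preconnected_of_eventuallyEq_zero
    hconv.isPreconnected (by simpa [ℓ] using ha) hev (show (1 : ℂ) ∈ _ by simpa [ℓ] using hb)
  simpa [ℓ] using this

end linear

/-! ### Holomorphic maps in charts and the identity theorem on manifolds. -/

/-- Equality of maps near `x`, read in charts. -/
theorem eventually_eq_iff_chart_sub {E F X Y : Type*} [NormedAddCommGroup E]
    [NormedAddCommGroup F] [TopologicalSpace X] [ChartedSpace E X] [TopologicalSpace Y]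
    [ChartedSpace F Y] {f g : X → Y} {x x' : X} (hx' : x' ∈ (chartAt E x).source)
    (hf : ∀ᶠ q in 𝓝 x', f q ∈ (chartAt F (f x)).source)
    (hg : ∀ᶠ q in 𝓝 x', g q ∈ (chartAt F (f x)).source) :
    (∀ᶠ q in 𝓝 x', f q = g q) ↔ ∀ᶠ y in 𝓝 (chartAt E x x'),
      chartAt F (f x) (f ((chartAt E x).symm y)) - chartAt F (f x) (g ((chartAt E x).symm y)) = 0 := by
  have hsymm := (chartAt E x).tendsto_symm hx'
  constructor
  · intro h
    filter_upwards [hsymm.eventually h] with y hy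
    rw [hy, sub_self]
  · intro h
    filter_upwards [((chartAt E x).continuousAt hx').eventually h, hf, hg,
      (chartAt E x).open_source.mem_nhds hx'] with q hq h1 h2 h3
    rw [(chartAt E x).left_inv h3, sub_eq_zero] at hq
    exact (chartAt F (f x)).injOn h1 h2 hq

section manifold

variable {E F : Type*} [NormedAddCommGroup E] [NormedSpace ℂ E]
  [NormedAddCommGroup F] [NormedSpace ℂ F]
  {X : Type*} [TopologicalSpace X] [ChartedSpace E X]
  {Y : Type*} [TopologicalSpace Y] [ChartedSpace F Y]

/-- A holomorphic map is real differentiable and its differential commutes with `J`. -/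
theorem MDifferentiableAt.real_and_tangentJ {f : X → Y} {x : X}
    (hf : MDifferentiableAt 𝓘(ℂ, E) 𝓘(ℂ, F) f x) :
    MDifferentiableAt 𝓘(ℝ, E) 𝓘(ℝ, F) f x ∧ ∀ w : TangentSpace 𝓘(ℝ, E) x,
      mfderiv 𝓘(ℝ, E) 𝓘(ℝ, F) f x (tangentJ w) = tangentJ (mfderiv 𝓘(ℝ, E) 𝓘(ℝ, F) f x w) := by
  have h := hf.hasMFDerivAt
  let L : E →L[ℂ] F := mfderiv 𝓘(ℂ, E) 𝓘(ℂ, F) f x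
  have h' : HasMFDerivAt 𝓘(ℝ, E) 𝓘(ℝ, F) f x (L.restrictScalars ℝ) :=
    ⟨h.1, HasFDerivWithinAt.restrictScalars ℝ h.2⟩
  refine ⟨h'.mdifferentiableAt, fun w => ?_⟩
  rw [h'.mfderiv]
  exact L.map_smul Complex.I w

/-- A real differentiable map whose differential commutes with `J` is holomorphic. -/
theorem MDifferentiableAt.complex_of_tangentJ {f : X → Y} {x : X}
    (hf : MDifferentiableAt 𝓘(ℝ, E) 𝓘(ℝ, F) f x) (hJ : ∀ w : TangentSpace 𝓘(ℝ, E) x,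
      mfderiv 𝓘(ℝ, E) 𝓘(ℝ, F) f x (tangentJ w) = tangentJ (mfderiv 𝓘(ℝ, E) 𝓘(ℝ, F) f x w)) :
    MDifferentiableAt 𝓘(ℂ, E) 𝓘(ℂ, F) f x := by
  have h := hf.hasMFDerivAt
  let D : E →L[ℝ] F := mfderiv 𝓘(ℝ, E) 𝓘(ℝ, F) f x
  have h2 : HasFDerivAt (writtenInExtChartAt 𝓘(ℝ, E) 𝓘(ℝ, F) x f) D (extChartAt 𝓘(ℝ, E) x x) := by
    rw [← hasFDerivWithinAt_univ, ← 𝓘(ℝ, E).range_eq_univ]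
    exact h.2
  obtain ⟨L, -, hL⟩ := HasFDerivAt.complex_of_map_I_smul h2 hJ
  have h' : HasMFDerivAt 𝓘(ℂ, E) 𝓘(ℂ, F) f x L := ⟨h.1, hL.hasFDerivWithinAt⟩
  exact h'.mdifferentiableAt

variable [IsManifold 𝓘(ℂ, E) ω X] [IsManifold 𝓘(ℂ, F) ω Y]

/-- Two holomorphic maps with equal value at `x`, read in charts: the difference is holomorphic. -/
theorem eventually_differentiableAt_chart_sub {f g : X → Y} (hf : MDifferentiable 𝓘(ℂ, E) 𝓘(ℂ, F) f)
    (hg : MDifferentiable 𝓘(ℂ, E) 𝓘(ℂ, F) g) {x : X} (hfg : f x = g x) :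
    ∀ᶠ y in 𝓝 (chartAt E x x), DifferentiableAt ℂ (fun y =>
      chartAt F (f x) (f ((chartAt E x).symm y)) - chartAt F (f x) (g ((chartAt E x).symm y))) y := by
  have : IsManifold 𝓘(ℂ, E) 1 X := .of_le (n := ω) le_top
  have : IsManifold 𝓘(ℂ, F) 1 Y := .of_le (n := ω) le_top
  have hsymm : Filter.Tendsto (chartAt E x).symm (𝓝 (chartAt E x x)) (𝓝 x) :=
    (chartAt E x).tendsto_symm (mem_chart_source E x)
  have hu : ∀ u : X → Y, MDifferentiable 𝓘(ℂ, E) 𝓘(ℂ, F) u → u x = f x →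
      ∀ᶠ y in 𝓝 (chartAt E x x),
        DifferentiableAt ℂ (fun y => chartAt F (f x) (u ((chartAt E x).symm y))) y := by
    intro u hu hux
    have h1 : ∀ᶠ q in 𝓝 x, u q ∈ (chartAt F (f x)).source :=
      (hu x).continuousAt.eventually_mem (hux ▸ chart_source_mem_nhds F (f x))
    filter_upwards [hsymm.eventually h1, chart_target_mem_nhds E x] with y hy hyt
    rw [← mdifferentiableAt_iff_differentiableAt]
    exact ((mdifferentiable_chart (f x)).mdifferentiableAt hy).comp y
      ((hu _).comp y ((mdifferentiable_chart x).mdifferentiableAt_symm hyt))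
  filter_upwards [hu f hf rfl, hu g hg hfg.symm] with y h1 h2
  exact h1.sub h2

/-- The identity theorem for holomorphic maps of connected complex manifolds. -/
theorem MDifferentiable.eq_of_eventually_eq [CompleteSpace F] [PreconnectedSpace X] [T2Space Y]
    {f g : X → Y}
    (hf : MDifferentiable 𝓘(ℂ, E) 𝓘(ℂ, F) f) (hg : MDifferentiable 𝓘(ℂ, E) 𝓘(ℂ, F) g) {p : X}
    (h : ∀ᶠ q in 𝓝 p, f q = g q) : f = g := by
  -- The set where the germs agree is open by definition; closedness is the content.
  let S : Set X := {x | ∀ᶠ q in 𝓝 x, f q = g q}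
  have hopen : IsOpen S := isOpen_setOfPred_eventually_nhds
  have hclosed : IsClosed S := by
    refine isClosed_of_closure_subset fun x hx => ?_
    have hfgx : f x = g x :=
      closure_minimal (t := {q | f q = g q})
        (fun q hq => Filter.Eventually.self_of_nhds (p := fun q => f q = g q) hq)
        (isClosed_eq hf.continuous hg.continuous) hx
    have hfs : ∀ᶠ q in 𝓝 x, f q ∈ (chartAt F (f x)).source :=
      (hf x).continuousAt.eventually_mem (chart_source_mem_nhds F (f x))
    have hgs : ∀ᶠ q in 𝓝 x, g q ∈ (chartAt F (f x)).source :=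
      (hg x).continuousAt.eventually_mem (hfgx ▸ chart_source_mem_nhds F (f x))
    obtain ⟨r, hr, hball⟩ :=
      Metric.eventually_nhds_iff_ball.1 (eventually_differentiableAt_chart_sub hf hg hfgx)
    have hnear : ∀ᶠ q in 𝓝 x, chartAt E x q ∈ Metric.ball (chartAt E x x) r :=
      ((chartAt E x).continuousAt (mem_chart_source E x)).eventually_mem (Metric.ball_mem_nhds _ hr)
    -- A point `x'` of `S` lying in a chart ball around `x` carries the vanishing of the difference
    -- over to the whole ball, hence to `x`.
    obtain ⟨x', ⟨hx'f, hx'g, hx'b, hx's⟩, hx'S⟩ := ((mem_closure_iff_frequently.1 hx).and_eventually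
      (hfs.eventually_nhds.and (hgs.eventually_nhds.and
        (hnear.and (chart_source_mem_nhds E x))))).exists.imp fun _ h => h.symm
    have h0 := (eventually_eq_iff_chart_sub hx's hx'f hx'g).1 hx'S
    have hzero := eqOn_zero_ball_of_eventually
      (fun y hy => (hball y hy).differentiableWithinAt) hx'b h0
    exact (eventually_eq_iff_chart_sub (mem_chart_source E x) hfs hgs).2
      (Filter.eventually_of_mem (Metric.ball_mem_nhds _ hr) hzero)
  have huniv : S = univ := IsClopen.eq_univ ⟨hclosed, hopen⟩ ⟨p, h⟩
  funext q
  have hq : q ∈ S := huniv ▸ mem_univ q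
  exact Filter.Eventually.self_of_nhds (p := fun q => f q = g q) hq

end manifold

/-! ### Fixed points of, and conjugation by, antiholomorphic maps. -/

section realform

variable {E F : Type*} [NormedAddCommGroup E] [NormedSpace ℂ E]
  [NormedAddCommGroup F] [NormedSpace ℂ F]

/-- Holomorphic maps agreeing on the fixed points of an antiholomorphic involution agree near each
of these fixed points. -/
theorem eventually_eq_of_eqOn_fixedPoints [FiniteDimensional ℂ E] [CompleteSpace F]
    {X : HermitianManifold.{u} E} {Y : Type*} [TopologicalSpace Y] [ChartedSpace F Y]
    [IsManifold 𝓘(ℂ, F) ω Y] {σ : X → X} (hσ : IsAntiholomorphic X σ)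
    (hinv : Function.Involutive σ) {f g : X → Y} (hf : MDifferentiable 𝓘(ℂ, E) 𝓘(ℂ, F) f)
    (hg : MDifferentiable 𝓘(ℂ, E) 𝓘(ℂ, F) g) (hfg : EqOn f g (Function.fixedPoints σ)) {p : X}
    (hp : σ p = p) : ∀ᶠ q in 𝓝 p, f q = g q := by
  have : IsManifold 𝓘(ℂ, E) 1 X := .of_le (n := ω) le_top
  have : IsManifold 𝓘(ℝ, E) 1 X := .of_le (n := ω) le_top
  have hfgp : f p = g p := hfg hp
  have hfs : ∀ᶠ q in 𝓝 p, f q ∈ (chartAt F (f p)).source :=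
    (hf p).continuousAt.eventually_mem (chart_source_mem_nhds F (f p))
  have hgs : ∀ᶠ q in 𝓝 p, g q ∈ (chartAt F (f p)).source :=
    (hg p).continuousAt.eventually_mem (hfgp ▸ chart_source_mem_nhds F (f p))
  rw [eventually_eq_iff_chart_sub (mem_chart_source E p) hfs hgs]
  let e := chartAt E p
  have hep : e.symm (e p) = p := e.left_inv (mem_chart_source E p)
  have hsymm : Filter.Tendsto e.symm (𝓝 (e p)) (𝓝 p) := e.tendsto_symm (mem_chart_source E p)
  have hσp : ∀ᶠ q in 𝓝 p, σ q ∈ e.source :=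
    hσ.1.continuous.continuousAt.eventually_mem (by rw [hp]; exact chart_source_mem_nhds E p)
  -- The germ result is applied to `σ` read in the single chart at `p`, possible because `σ p = p`.
  refine eventually_eq_zero_of_eq_zero_on_fixed (s := fun y => e (σ (e.symm y))) ?_ ?_ ?_ ?_
    (eventually_differentiableAt_chart_sub hf hg hfgp) ?_
  · rw [← contMDiffAt_iff_contDiffAt]
    have h1 : ContMDiffAt 𝓘(ℝ, E) 𝓘(ℝ, E) 1 e.symm (e p) :=
      contMDiffOn_chart_symm.contMDiffAt (chart_target_mem_nhds E p)
    have h2 : ContMDiffAt 𝓘(ℝ, E) 𝓘(ℝ, E) 1 σ (e.symm (e p)) := (hσ.1 _).of_le (by norm_cast)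
    have h3 : ContMDiffAt 𝓘(ℝ, E) 𝓘(ℝ, E) 1 e (σ (e.symm (e p))) := by
      rw [hep, hp]
      exact contMDiffOn_chart.contMDiffAt (chart_source_mem_nhds E p)
    exact ContMDiffAt.comp (g := e) (e p) h3 (h2.comp (e p) h1)
  · exact congrArg e ((congrArg σ hep).trans hp)
  · filter_upwards [hsymm.eventually hσp, chart_target_mem_nhds E p] with y hy hyt w
    obtain ⟨h1, h1J⟩ := ((mdifferentiable_chart (I := 𝓘(ℂ, E)) p).mdifferentiableAt_symm
      hyt).real_and_tangentJ
    obtain ⟨h3, h3J⟩ := ((mdifferentiable_chart (I := 𝓘(ℂ, E)) p).mdifferentiableAt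
      hy).real_and_tangentJ
    have h2 := hσ.1.mdifferentiable (by simp) (e.symm y)
    let D₁ : E →L[ℝ] E := mfderiv 𝓘(ℝ, E) 𝓘(ℝ, E) e.symm y
    let D₂ : E →L[ℝ] E := mfderiv 𝓘(ℝ, E) 𝓘(ℝ, E) σ (e.symm y)
    let D₃ : E →L[ℝ] E := mfderiv 𝓘(ℝ, E) 𝓘(ℝ, E) e (σ (e.symm y))
    have h1I : D₁ (Complex.I • w) = Complex.I • D₁ w := h1J w
    have h2I : D₂ (Complex.I • D₁ w) = -(Complex.I • D₂ (D₁ w)) := hσ.2 (e.symm y) (D₁ w)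
    have h3I : D₃ (Complex.I • D₂ (D₁ w)) = Complex.I • D₃ (D₂ (D₁ w)) := h3J (D₂ (D₁ w))
    have hcomp : HasFDerivAt (fun y => e (σ (e.symm y))) (D₃.comp (D₂.comp D₁)) y :=
      hasMFDerivAt_iff_hasFDerivAt.1
        (h3.hasMFDerivAt.comp y (h2.hasMFDerivAt.comp y h1.hasMFDerivAt))
    rw [hcomp.fderiv]
    simp only [ContinuousLinearMap.comp_apply, h1I, h2I, map_neg, h3I]
  · filter_upwards [hsymm.eventually hσp, chart_target_mem_nhds E p] with y hy hyt
    rw [e.left_inv hy, hinv, e.right_inv hyt]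
  · filter_upwards [hsymm.eventually hσp, chart_target_mem_nhds E p] with y hy hyt hfix
    have : σ (e.symm y) = e.symm y := by
      rw [← e.left_inv hy, hfix]
    exact sub_eq_zero.2 (congrArg _ (hfg this))

/-- Conjugating a holomorphic map by antiholomorphic maps gives a holomorphic map. -/
theorem IsAntiholomorphic.comp_mdifferentiable_comp {X : HermitianManifold.{u} E}
    {Y : HermitianManifold.{v} F} {σ : X → X} {τ : Y → Y} (hσ : IsAntiholomorphic X σ)
    (hτ : IsAntiholomorphic Y τ) {f : X → Y} (hf : MDifferentiable 𝓘(ℂ, E) 𝓘(ℂ, F) f) :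
    MDifferentiable 𝓘(ℂ, E) 𝓘(ℂ, F) (τ ∘ f ∘ σ) := by
  intro x
  obtain ⟨h2, h2J⟩ := (hf (σ x)).real_and_tangentJ
  have h1 := hσ.1.mdifferentiable (by simp) x
  have h3 := hτ.1.mdifferentiable (by simp) (f (σ x))
  have hcomp := h3.hasMFDerivAt.comp x (h2.hasMFDerivAt.comp x h1.hasMFDerivAt)
  refine hcomp.mdifferentiableAt.complex_of_tangentJ fun w => ?_
  rw [hcomp.mfderiv]
  -- `σ` contributes one sign and `τ` a second; they cancel.
  have hneg : mfderiv 𝓘(ℝ, E) 𝓘(ℝ, F) f (σ x) (mfderiv 𝓘(ℝ, E) 𝓘(ℝ, E) σ x (tangentJ w)) =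
      -tangentJ (mfderiv 𝓘(ℝ, E) 𝓘(ℝ, F) f (σ x) (mfderiv 𝓘(ℝ, E) 𝓘(ℝ, E) σ x w)) := by
    rw [hσ.2, map_neg, h2J]
  refine (congrArg (mfderiv 𝓘(ℝ, F) 𝓘(ℝ, F) τ (f (σ x))) hneg).trans ?_
  refine (map_neg _ _).trans ?_
  rw [hτ.2]
  exact neg_neg _

end realform

theorem theorem6p3 {E F : Type*} [NormedAddCommGroup E] [NormedSpace ℂ E] [FiniteDimensional ℂ E]
    [NormedAddCommGroup F] [NormedSpace ℂ F] [FiniteDimensional ℂ F]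
    (M : HermitianSymmetricSpace.{u} E) (N : HermitianSymmetricSpace.{v} F)
    (σ₁ : M → M) (B₁ : Set M) (hB₁ : IsRecursiveRealForm M σ₁ B₁)
    (σ₂ : N → N) (B₂ : Set N) (hB₂ : IsRealForm N.toHermitianManifold σ₂ B₂)
    (f : M → N) (hf : MDifferentiable 𝓘(ℂ, E) 𝓘(ℂ, F) f) (hfB : MapsTo f B₁ B₂) :
    ∀ p : M, f (σ₁ p) = σ₂ (f p) := by
  have : CompleteSpace F := FiniteDimensional.complete ℂ F
  have h₁ := hB₁.isRealForm
  have hg := h₁.antiholomorphic.comp_mdifferentiable_comp hB₂.antiholomorphic hf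
  obtain ⟨b, hb⟩ := h₁.nonempty
  have hfg : EqOn f (σ₂ ∘ f ∘ σ₁) (Function.fixedPoints σ₁) := by
    intro q hq
    have h2 : f q ∈ Function.fixedPoints σ₂ :=
      hB₂.eq_fixedPoints ▸ hfB (h₁.eq_fixedPoints ▸ hq)
    have h1 : σ₁ q = q := hq
    rw [Function.comp_apply, Function.comp_apply, h1]
    exact h2.symm
  have hbfix : σ₁ b = b := by
    rw [h₁.eq_fixedPoints] at hb
    exact hb
  have heq : f = σ₂ ∘ f ∘ σ₁ := hf.eq_of_eventually_eq hg
    (eventually_eq_of_eqOn_fixedPoints h₁.antiholomorphic h₁.isometry.involutive hf hg hfg hbfix)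
  intro p
  -- At `σ₁ p` the inner `σ₁` cancels, leaving the claim.
  have h := congrFun heq (σ₁ p)
  rwa [Function.comp_apply, Function.comp_apply, h₁.isometry.involutive p] at h
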